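/- There is a universal constant $C>0$ such that the following holds for all $m,n$ and every matrix $A\in\{0,1\}^{m\times n}$ that has at least two distinct rows. Let $\dim(A)$ be the VC dimension of $A$, i.e. the largest size of a set $Y\subseteq[n]$ of columns such that every subset of $Y$ has the form $\{j\in Y : A_{ij}=1\}$ for some row $i$. For a real matrix $B$ with $k$ columns let $\mathrm{disc}(B)=\min_{x\in\{-1,1\}^k}\|Bx\|_\infty$, and let $\mathrm{herdisc}(A)$ be the maximum of $\mathrm{disc}(B)$ over all submatrices $B$ of $A$. Then \[\mathrm{herdisc}(A)\le C\sqrt{n\cdot\dim(A)}.\] Moreover, the bound is witnessed by a uniformly random coloring: for every submatrix $B$ of $A$ with $k$ columns, and $x$ uniformly distributed on $\{-1,1\}^k$, \[\mathbb{E}\,\|Bx\|_\infty\le C\sqrt{n\cdot\dim(A)}.\] -/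

import Mathlib

open scoped BigOperators

noncomputable section

namespace HerDisc

variable {ι κ : Type*} [Fintype ι] [Fintype κ]

/-- The real vector of signs of a colouring; the units of `ℤ` are exactly `1` and `-1`. -/
def signVec (x : κ → ℤˣ) : κ → ℝ := fun j => ((x j : ℤ) : ℝ)

/-- The discrepancy `disc(A, x) = ‖A x‖_∞` of a real matrix with respect to a colouring `x`
(the norm on `ι → ℝ` is the maximum norm). -/
def discColoring (A : Matrix ι κ ℝ) (x : κ → ℤˣ) : ℝ := ‖A.mulVec (signVec x)‖

/-- The discrepancy of a real matrix: the minimum of `‖A x‖_∞` over the finitely many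
colourings `x` of the columns. -/
def disc (A : Matrix ι κ ℝ) : ℝ := ⨅ x : κ → ℤˣ, discColoring A x

/-- The submatrix of `A` with row set `I` and column set `J`. -/
def sub (A : Matrix ι κ ℝ) (I : Finset ι) (J : Finset κ) : Matrix I J ℝ :=
  A.submatrix Subtype.val Subtype.val

/-- The hereditary discrepancy: the maximum of the discrepancies of the finitely many
submatrices of `A`. -/
def herdisc (A : Matrix ι κ ℝ) : ℝ := ⨆ S : Finset ι × Finset κ, disc (sub A S.1 S.2)

open Classical in
/-- The set system on the columns whose incidence matrix is `A`: the supports of the rows. -/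
def rowSets [DecidableEq κ] (A : Matrix ι κ ℝ) : Finset (Finset κ) :=
  Finset.univ.image fun i => Finset.univ.filter fun j => A i j = 1

/-- The VC dimension of a `0/1` matrix: the largest size of a set of columns that is shattered
by the set system of the rows. -/
def vcDim [DecidableEq κ] (A : Matrix ι κ ℝ) : ℕ := (rowSets A).vcDim

end HerDisc

end

/-
Under a uniformly random colouring the signed sums of the rows form a sub-Gaussian process for the
metric `√|S ∆ T|` on sets of columns. With `d` the VC dimension, sets that pairwise differ in at
least `n / Q` columns number at most `Q ^ O(d)`: few random columns already tell them apart, and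
the Sauer–Shelah lemma counts their traces on these columns. Hence the rows can be approximated up
to `n / 4 ^ k` columns by `exp (O(d (k + 1)))` sets. Chaining along these approximations, the `k`-th
links contribute `O((k + 1) / 2 ^ k) * √(n d)`, which is summable, so that no logarithm is lost.
-/

open Finset
open scoped symmDiff

namespace HerDisc

section Trace

variable {α β : Type*} [Fintype α] [DecidableEq α] [DecidableEq β]

/-- The trace of a set family along a map `f`, i.e. the family of the preimages under `f` of its
members. For an inclusion this restricts the family to a subset; for a map from `Fin s` it restricts
the family to a sample of `s` points, repetitions allowed. -/
def trace (f : α → β) (𝓕 : Finset (Finset β)) : Finset (Finset α) :=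
  𝓕.image fun S ↦ ({a | f a ∈ S} : Finset α)

lemma vcDim_trace_le (f : α → β) (𝓕 : Finset (Finset β)) : (trace f 𝓕).vcDim ≤ 𝓕.vcDim := by
  refine Finset.sup_le fun U hU ↦ ?_
  replace hU : ∀ t ⊆ U, ∃ S ∈ 𝓕, ∀ a ∈ U, f a ∈ S ↔ a ∈ t := fun t ht ↦ by
    obtain ⟨R, hR, rfl⟩ := mem_shatterer.1 hU ht
    obtain ⟨S, hS, rfl⟩ := mem_image.1 hR
    exact ⟨S, hS, fun a ha ↦ by simp [ha]⟩
  have f_injOn : Set.InjOn f U := fun a ha b hb hab ↦ by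
    obtain ⟨S, -, hS⟩ := hU {a} (singleton_subset_iff.2 ha)
    have hbS : f b ∈ S := hab ▸ (hS a ha).2 (mem_singleton_self a)
    exact (mem_singleton.1 ((hS b hb).1 hbS)).symm
  have image_shattered : 𝓕.Shatters (U.image f) := fun t' ht' ↦ by
    obtain ⟨t, ht, rfl⟩ := subset_image_iff.1 ht'
    obtain ⟨S, hS, hSt⟩ := hU t ht
    refine ⟨S, hS, ?_⟩
    ext b
    simp only [mem_inter, mem_image]
    constructor
    · rintro ⟨⟨a, ha, rfl⟩, haS⟩
      exact ⟨a, (hSt a ha).1 haS, rfl⟩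
    · rintro ⟨a, ha, rfl⟩
      exact ⟨⟨a, ht ha, rfl⟩, (hSt a (ht ha)).2 ha⟩
  exact (card_image_of_injOn f_injOn).ge.trans image_shattered.card_le_vcDim

end Trace

section SauerShelah

variable {α : Type*} [DecidableEq α]

lemma one_le_vcDim_of_one_lt_card {𝓕 : Finset (Finset α)} (h𝓕 : 1 < #𝓕) : 1 ≤ 𝓕.vcDim := by
  by_contra! h
  have hshatterer : 𝓕.shatterer ⊆ {∅} := fun U hU ↦ by
    have := (mem_shatterer.1 hU).card_le_vcDim
    rw [mem_singleton, ← card_eq_zero]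
    omega
  exact h𝓕.not_ge ((card_le_card_shatterer 𝓕).trans (card_le_card hshatterer))

lemma pow_mul_sum_choose_le (s d : ℕ) {t : ℝ} (ht₀ : 0 ≤ t) (ht₁ : t ≤ 1) :
    t ^ d * ∑ i ∈ Iic d, (s.choose i : ℝ) ≤ (t + 1) ^ s := by
  have choose_mul_nonneg : ∀ i, 0 ≤ t ^ i * (s.choose i : ℝ) := fun i ↦ by positivity
  calc t ^ d * ∑ i ∈ Iic d, (s.choose i : ℝ)
      ≤ ∑ i ∈ Iic d, t ^ i * (s.choose i : ℝ) := by
        rw [mul_sum]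
        gcongr ∑ i ∈ _, ?_ * _ with i hi
        exact pow_le_pow_of_le_one ht₀ ht₁ (mem_Iic.1 hi)
    _ ≤ ∑ i ∈ Iic (max d s), t ^ i * (s.choose i : ℝ) :=
        sum_le_sum_of_subset_of_nonneg (Iic_subset_Iic.2 (le_max_left d s))
          fun i _ _ ↦ choose_mul_nonneg i
    _ = ∑ i ∈ Iic s, t ^ i * (s.choose i : ℝ) := by
        refine (sum_subset (Iic_subset_Iic.2 (le_max_right d s)) fun i _ hi ↦ ?_).symm
        rw [Nat.choose_eq_zero_of_lt (by simpa using hi), Nat.cast_zero, mul_zero]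
    _ = (t + 1) ^ s := by simp [add_pow, Nat.range_succ_eq_Iic]

lemma card_le_sum_choose_vcDim [Fintype α] (𝓕 : Finset (Finset α)) :
    #𝓕 ≤ ∑ i ∈ Iic 𝓕.vcDim, (Fintype.card α).choose i :=
  (card_le_card_shatterer 𝓕).trans card_shatterer_le_sum_vcDim

lemma card_le_inv_pow_mul_exp [Fintype α] {𝓕 : Finset (Finset α)} {d : ℕ} (h𝓕 : 𝓕.vcDim ≤ d) {t : ℝ}
    (ht₀ : 0 < t) (ht₁ : t ≤ 1) :
    (#𝓕 : ℝ) ≤ (t ^ d)⁻¹ * Real.exp (t * Fintype.card α) := by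
  rw [le_inv_mul_iff₀ (by positivity)]
  calc t ^ d * (#𝓕 : ℝ)
      ≤ t ^ d * ∑ i ∈ Iic d, ((Fintype.card α).choose i : ℝ) := by
        gcongr
        exact_mod_cast (card_le_sum_choose_vcDim 𝓕).trans
          (sum_le_sum_of_subset (Iic_subset_Iic.2 h𝓕))
    _ ≤ (t + 1) ^ Fintype.card α := pow_mul_sum_choose_le _ _ ht₀.le ht₁
    _ ≤ Real.exp t ^ Fintype.card α := by
        gcongr
        exact Real.add_one_le_exp t
    _ = Real.exp (t * Fintype.card α) := by rw [mul_comm, Real.exp_nat_mul]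

end SauerShelah

section Packing

variable {α : Type*} [Fintype α]

lemma card_piFinset_compl_le [DecidableEq α] {Q : ℝ} (hQ : 0 < Q) {D : Finset α}
    (hD : (Fintype.card α : ℝ) ≤ Q * #D) (s : ℕ) :
    (#(Fintype.piFinset fun _ : Fin s ↦ Dᶜ) : ℝ)
      ≤ (Fintype.card α : ℝ) ^ s * Real.exp (-(s / Q)) := by
  have hcompl : (#Dᶜ : ℝ) ≤ Fintype.card α * Real.exp (-Q⁻¹) :=
    calc (#Dᶜ : ℝ) = Fintype.card α - #D := by rw [card_compl, Nat.cast_sub (card_le_univ D)]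
      _ ≤ Fintype.card α - Fintype.card α / Q := by
          gcongr
          rwa [div_le_iff₀' hQ]
      _ = Fintype.card α * (-Q⁻¹ + 1) := by ring
      _ ≤ Fintype.card α * Real.exp (-Q⁻¹) := by
          gcongr
          exact Real.add_one_le_exp _
  calc (#(Fintype.piFinset fun _ : Fin s ↦ Dᶜ) : ℝ) = (#Dᶜ : ℝ) ^ s := by
        rw [Fintype.card_piFinset_const, Nat.cast_pow]
    _ ≤ (Fintype.card α * Real.exp (-Q⁻¹)) ^ s := by gcongr
    _ = (Fintype.card α : ℝ) ^ s * Real.exp (-(s / Q)) := by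
        rw [mul_pow, ← Real.exp_nat_mul, mul_neg, div_eq_mul_inv]

lemma exists_sample_hitting [Nonempty α] {Q : ℝ} (hQ : 0 < Q) {𝓓 : Finset (Finset α)}
    (h𝓓 : ∀ D ∈ 𝓓, (Fintype.card α : ℝ) ≤ Q * #D) {s : ℕ}
    (hs : #𝓓 * Real.exp (-(s / Q)) < 1) :
    ∃ f : Fin s → α, ∀ D ∈ 𝓓, ∃ i, f i ∈ D := by
  classical
  by_contra! hmiss
  let missing (D : Finset α) : Finset (Fin s → α) := Fintype.piFinset fun _ ↦ Dᶜ
  have huniv : univ ⊆ 𝓓.biUnion missing := fun f _ ↦ by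
    obtain ⟨D, hD, hf⟩ := hmiss f
    exact mem_biUnion.2 ⟨D, hD, Fintype.mem_piFinset.2 fun i ↦ mem_compl.2 (hf i)⟩
  have hcard : (Fintype.card α : ℝ) ^ s < (Fintype.card α : ℝ) ^ s :=
    calc (Fintype.card α : ℝ) ^ s = #(univ : Finset (Fin s → α)) := by simp
      _ ≤ ∑ D ∈ 𝓓, (#(missing D) : ℝ) := by
          exact_mod_cast (card_le_card huniv).trans card_biUnion_le
      _ ≤ ∑ _D ∈ 𝓓, (Fintype.card α : ℝ) ^ s * Real.exp (-(s / Q)) :=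
          sum_le_sum fun _ hD ↦ card_piFinset_compl_le hQ (h𝓓 _ hD) s
      _ = (Fintype.card α : ℝ) ^ s * (#𝓓 * Real.exp (-(s / Q))) := by
          rw [sum_const, nsmul_eq_mul]
          ring
      _ < (Fintype.card α : ℝ) ^ s := mul_lt_of_lt_one_right (by positivity) hs
  exact hcard.false

variable [DecidableEq α]

lemma exists_card_trace_eq [Nonempty α] {Q : ℝ} (hQ : 0 < Q) {𝓖 : Finset (Finset α)}
    (h𝓖 : (𝓖 : Set (Finset α)).Pairwise fun S T ↦ (Fintype.card α : ℝ) ≤ Q * #(S ∆ T)) {s : ℕ}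
    (hs : (#𝓖 : ℝ) ^ 2 * Real.exp (-(s / Q)) < 1) :
    ∃ f : Fin s → α, #(trace f 𝓖) = #𝓖 := by
  let 𝓓 : Finset (Finset α) := 𝓖.offDiag.image fun p ↦ p.1 ∆ p.2
  have h𝓓 : (#𝓓 : ℝ) ≤ (#𝓖 : ℝ) ^ 2 := by
    have : #𝓓 ≤ #𝓖 * #𝓖 := card_image_le.trans ((offDiag_card 𝓖).trans_le (Nat.sub_le _ _))
    rw [sq]
    exact_mod_cast this
  obtain ⟨f, hf⟩ := exists_sample_hitting hQ (𝓓 := 𝓓) (s := s)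
    (forall_mem_image.2 fun p hp ↦
      have ⟨h₁, h₂, hne⟩ := mem_offDiag.1 hp
      h𝓖 h₁ h₂ hne)
    (hs.trans_le' (by gcongr))
  refine ⟨f, card_image_of_injOn fun S hS T hT hST ↦ ?_⟩
  by_contra hne
  obtain ⟨i, hi⟩ := hf (S ∆ T) (mem_image.2 ⟨(S, T), mem_offDiag.2 ⟨hS, hT, hne⟩, rfl⟩)
  have hiff : f i ∈ S ↔ f i ∈ T := by simpa using Finset.ext_iff.1 hST i
  rw [mem_symmDiff] at hi
  tauto

lemma log_card_le_of_separated [Nonempty α] {𝓖 : Finset (Finset α)} {d : ℕ} (hd : 𝓖.vcDim ≤ d)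
    {Q : ℝ} (hQ : 1 ≤ Q)
    (h𝓖 : (𝓖 : Set (Finset α)).Pairwise fun S T ↦ (Fintype.card α : ℝ) ≤ Q * #(S ∆ T)) :
    Real.log #𝓖 ≤ 2 * d * Real.log (4 * Q) + 1 / 2 := by
  rcases 𝓖.eq_empty_or_nonempty with rfl | hne
  · have := Real.log_nonneg (by linarith : 1 ≤ 4 * Q)
    simp only [card_empty, Nat.cast_zero, Real.log_zero]
    positivity
  have hQ₀ : 0 < Q := by linarith
  have hcard : (0 : ℝ) < #𝓖 := by exact_mod_cast hne.card_pos
  set L := Real.log #𝓖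
  have : 0 ≤ L := Real.log_natCast_nonneg _
  set s := ⌊2 * Q * L⌋₊ + 1 with hs
  have hs_gt : 2 * Q * L < s := by exact_mod_cast Nat.lt_floor_add_one (2 * Q * L)
  have hs_le : (s : ℝ) ≤ 2 * Q * L + 1 := by
    rw [hs, Nat.cast_add_one]
    gcongr
    exact Nat.floor_le (by positivity)
  obtain ⟨f, hf⟩ := exists_card_trace_eq hQ₀ h𝓖 (s := s) (by
    have : 2 * L < s / Q := by rw [lt_div_iff₀ hQ₀]; linarith
    rw [← Real.exp_log hcard, ← Real.exp_nat_mul, ← Real.exp_add, Real.exp_lt_one_iff]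
    push_cast
    linarith)
  have hcard_le : (#𝓖 : ℝ) ≤ (((4 * Q)⁻¹) ^ d)⁻¹ * Real.exp ((4 * Q)⁻¹ * s) := by
    simpa only [hf, Fintype.card_fin] using
      card_le_inv_pow_mul_exp ((vcDim_trace_le f 𝓖).trans hd) (t := (4 * Q)⁻¹) (by positivity)
        (inv_le_one_of_one_le₀ (by linarith))
  have hlog : L ≤ d * Real.log (4 * Q) + (4 * Q)⁻¹ * s := by
    have := Real.log_le_log hcard hcard_le
    rwa [Real.log_mul (by positivity) (by positivity), Real.log_exp, inv_pow, inv_inv,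
      Real.log_pow] at this
  have hsample : (4 * Q)⁻¹ * s ≤ L / 2 + 1 / 4 := by
    rw [inv_mul_le_iff₀ (by positivity)]
    linarith
  linarith

end Packing

section Approximation

lemma exists_maximal_pairwise_not {α : Type*} {r : α → α → Prop} (hrefl : ∀ a, r a a)
    (hsymm : ∀ a b, r a b → r b a) (s : Finset α) :
    ∃ t ⊆ s, (t : Set α).Pairwise (fun a b ↦ ¬ r a b) ∧ ∀ a ∈ s, ∃ b ∈ t, r a b := by
  classical
  induction s using Finset.induction_on with
  | empty => exact ⟨∅, by simp⟩
  | insert a s _ ih =>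
    obtain ⟨t, hts, htr, hst⟩ := ih
    by_cases ha : ∃ b ∈ t, r a b
    · exact ⟨t, hts.trans (subset_insert a s), htr, forall_mem_insert .. |>.2 ⟨ha, hst⟩⟩
    · push Not at ha
      refine ⟨insert a t, insert_subset_insert a hts, ?_, forall_mem_insert .. |>.2
        ⟨⟨a, mem_insert_self a t, hrefl a⟩, fun b hb ↦ ?_⟩⟩
      · rw [coe_insert]
        exact htr.insert fun b hb _ ↦ ⟨ha b hb, fun h ↦ ha b hb (hsymm b a h)⟩
      · obtain ⟨c, hc, hbc⟩ := hst b hb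
        exact ⟨c, mem_insert_of_mem hc, hbc⟩

lemma log_natCast_mono {a b : ℕ} (h : a ≤ b) : Real.log a ≤ Real.log b := by
  rcases a.eq_zero_or_pos with rfl | ha
  · simpa using Real.log_natCast_nonneg b
  · exact Real.log_le_log (by exact_mod_cast ha) (by exact_mod_cast h)

variable {κ : Type*} [Fintype κ] [DecidableEq κ]

lemma exists_approximation [Nonempty κ] {𝓕 : Finset (Finset κ)} {d : ℕ} (hd : 1 ≤ d)
    (h𝓕 : 𝓕.vcDim ≤ d) (k : ℕ) :
    ∃ p : Finset κ → Finset κ, Real.log #(𝓕.image p) ≤ 4 * d * (k + 1) ∧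
      ∀ S ∈ 𝓕, 4 ^ k * (#(S ∆ p S) : ℝ) ≤ Fintype.card κ := by
  obtain ⟨𝓖, h𝓖𝓕, hsep, hnet⟩ := exists_maximal_pairwise_not
    (r := fun S T : Finset κ ↦ 4 ^ k * (#(S ∆ T) : ℝ) ≤ Fintype.card κ) (by simp)
    (fun S T ↦ by rw [symmDiff_comm]; exact id) 𝓕
  choose! p hp𝓖 hp using hnet
  refine ⟨p, ?_, hp⟩
  have hlog₄ : Real.log (4 * 4 ^ k) ≤ 3 / 2 * (k + 1) := by
    have : (4 : ℝ) * 4 ^ k = 2 ^ (2 * (k + 1)) := by rw [pow_mul]; norm_num [pow_succ']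
    rw [this, Real.log_pow]
    push_cast
    nlinarith [Real.log_two_lt_d9]
  have hd' : (1 : ℝ) ≤ d := by exact_mod_cast hd
  calc Real.log #(𝓕.image p)
      ≤ Real.log #𝓖 := log_natCast_mono (card_le_card (image_subset_iff.2 hp𝓖))
    _ ≤ 2 * d * Real.log (4 * 4 ^ k) + 1 / 2 :=
        log_card_le_of_separated ((vcDim_mono h𝓖𝓕).trans h𝓕) (one_le_pow₀ (by norm_num))
          (hsep.mono' fun S T h ↦ (not_le.1 h).le)
    _ ≤ 2 * d * (3 / 2 * (k + 1)) + 1 / 2 := by gcongr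
    _ ≤ 4 * d * (k + 1) := by nlinarith

/-- A sequence of successive approximations of the members of a set family `𝓕` on `κ` of VC
dimension at most `d`, as needed for chaining: the `k`-th approximation errs on at most
`card κ / 4 ^ k` points and takes at most `exp (4 * d * (k + 1))` values, and the sequence starts
with the empty set. -/
structure IsChainingSeq (𝓕 : Finset (Finset κ)) (d : ℕ) (p : ℕ → Finset κ → Finset κ) : Prop where
  zero_eq_empty : ∀ S, p 0 S = ∅
  log_card_image_le : ∀ k, Real.log #(𝓕.image (p k)) ≤ 4 * d * (k + 1)
  pow_mul_card_symmDiff_le : ∀ k, ∀ S ∈ 𝓕, 4 ^ k * (#(S ∆ p k S) : ℝ) ≤ Fintype.card κ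

lemma exists_isChainingSeq [Nonempty κ] {𝓕 : Finset (Finset κ)} {d : ℕ} (hd : 1 ≤ d)
    (h𝓕 : 𝓕.vcDim ≤ d) : ∃ p, IsChainingSeq 𝓕 d p := by
  choose p hlog hp using exists_approximation hd h𝓕
  refine ⟨fun | 0 => fun _ ↦ ∅ | k + 1 => p (k + 1), fun _ ↦ rfl, ?_, ?_⟩
  · rintro (_ | k)
    · have : #(𝓕.image fun _ ↦ (∅ : Finset κ)) ≤ 1 :=
        (card_le_card (image_subset_iff.2 fun _ _ ↦ mem_singleton_self ∅)).trans_eq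
          (card_singleton ∅)
      exact (Real.log_nonpos (by positivity) (by exact_mod_cast this)).trans (by positivity)
    · exact hlog (k + 1)
  · rintro (_ | k) S hS
    · have : #(S ∆ ∅) ≤ Fintype.card κ := card_le_univ _
      simpa using this
    · exact hp (k + 1) S hS

namespace IsChainingSeq

variable {𝓕 : Finset (Finset κ)} {d : ℕ} {p : ℕ → Finset κ → Finset κ} {S : Finset κ}

lemma apply_card_eq (hp : IsChainingSeq 𝓕 d p) (hS : S ∈ 𝓕) : p (Fintype.card κ) S = S := by
  by_contra hne
  have hpos : (1 : ℝ) ≤ #(S ∆ p (Fintype.card κ) S) := by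
    have : (S ∆ p (Fintype.card κ) S).Nonempty := by
      rw [symmDiff_nonempty]
      exact Ne.symm hne
    exact_mod_cast this.card_pos
  have hlt : (Fintype.card κ : ℝ) < 4 ^ Fintype.card κ := by
    exact_mod_cast Nat.lt_pow_self (by norm_num : 1 < 4)
  exact (hp.pow_mul_card_symmDiff_le _ S hS).not_gt
    (hlt.trans_le (le_mul_of_one_le_right (by positivity) hpos))

lemma card_symmDiff_succ_le (hp : IsChainingSeq 𝓕 d p) (k : ℕ) (hS : S ∈ 𝓕) :
    (#(p (k + 1) S ∆ p k S) : ℝ) ≤ 2 * Fintype.card κ / 4 ^ k := by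
  have htri : (#(p (k + 1) S ∆ p k S) : ℝ) ≤ #(S ∆ p (k + 1) S) + #(S ∆ p k S) := by
    have := (card_le_card (symmDiff_triangle (p (k + 1) S) S (p k S))).trans (card_union_le _ _)
    rw [symmDiff_comm (p (k + 1) S) S] at this
    exact_mod_cast this
  have hsucc : 4 ^ k * (#(S ∆ p (k + 1) S) : ℝ) ≤ Fintype.card κ := by
    refine le_trans ?_ (hp.pow_mul_card_symmDiff_le (k + 1) S hS)
    gcongr <;> norm_num
  rw [le_div_iff₀' (by positivity)]
  calc (4 : ℝ) ^ k * #(p (k + 1) S ∆ p k S)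
      ≤ 4 ^ k * (#(S ∆ p (k + 1) S) + #(S ∆ p k S)) := by gcongr
    _ ≤ 2 * Fintype.card κ := by linarith [hp.pow_mul_card_symmDiff_le k S hS]

lemma log_card_image_pair_le (hp : IsChainingSeq 𝓕 d p) (k : ℕ) :
    Real.log #(𝓕.image fun S ↦ (p (k + 1) S, p k S)) ≤ d * (8 * k + 12) := by
  rcases 𝓕.eq_empty_or_nonempty with rfl | hne
  · simp only [image_empty, card_empty, Nat.cast_zero, Real.log_zero]
    positivity
  have hcard : #(𝓕.image fun S ↦ (p (k + 1) S, p k S))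
      ≤ #(𝓕.image (p (k + 1))) * #(𝓕.image (p k)) := by
    rw [← card_product]
    exact card_le_card (image_subset_iff.2 fun S hS ↦
      mk_mem_product (mem_image_of_mem _ hS) (mem_image_of_mem _ hS))
  have hpos : ∀ j, (#(𝓕.image (p j)) : ℝ) ≠ 0 := fun j ↦
    Nat.cast_ne_zero.2 (hne.image _).card_ne_zero
  have hlog := log_natCast_mono hcard
  have hsucc := hp.log_card_image_le (k + 1)
  push_cast at hlog hsucc
  rw [Real.log_mul (hpos _) (hpos _)] at hlog
  linarith [hp.log_card_image_le k]

end IsChainingSeq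

end Approximation

section MaximalInequality

variable {Ω ι : Type*} [Fintype Ω] [Nonempty Ω]

lemma exp_expect_le_expect_exp (f : Ω → ℝ) : Real.exp (𝔼 ω, f ω) ≤ 𝔼 ω, Real.exp (f ω) := by
  have := convexOn_exp.map_sum_le (t := univ) (w := fun _ : Ω ↦ (Fintype.card Ω : ℝ)⁻¹) (p := f)
    (fun _ _ ↦ by positivity) (by simp) (fun _ _ ↦ Set.mem_univ _)
  simpa only [smul_eq_mul, ← mul_sum, Fintype.expect_eq_sum_div_card, div_eq_inv_mul] using this

lemma expect_selection_le_log {V : Finset ι} {Z : ι → Ω → ℝ} {B l : ℝ} (hl : 0 < l)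
    (hZ : ∀ v ∈ V, 𝔼 ω, Real.exp (l * Z v ω) ≤ B) {v : Ω → ι} (hv : ∀ ω, v ω ∈ V) :
    𝔼 ω, Z (v ω) ω ≤ Real.log (#V * B) / l := by
  rw [le_div_iff₀' hl, mul_expect]
  have hexp : Real.exp (𝔼 ω, l * Z (v ω) ω) ≤ #V * B := calc
    Real.exp (𝔼 ω, l * Z (v ω) ω) ≤ 𝔼 ω, Real.exp (l * Z (v ω) ω) := exp_expect_le_expect_exp _
    _ ≤ 𝔼 ω, ∑ u ∈ V, Real.exp (l * Z u ω) := expect_le_expect fun ω _ ↦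
        single_le_sum (f := fun u ↦ Real.exp (l * Z u ω)) (fun _ _ ↦ by positivity) (hv ω)
    _ = ∑ u ∈ V, 𝔼 ω, Real.exp (l * Z u ω) := expect_sum_comm ..
    _ ≤ #V * B := by
        rw [← nsmul_eq_mul]
        exact sum_le_card_nsmul _ _ _ hZ
  rwa [Real.le_log_iff_exp_le ((Real.exp_pos _).trans_le hexp)]

end MaximalInequality

section Signs

variable {κ : Type*} [Fintype κ] [DecidableEq κ]

lemma expect_exp_sum_mul_signVec (w : κ → ℝ) :
    𝔼 x : κ → ℤˣ, Real.exp (∑ j, w j * signVec x j) = ∏ j, Real.cosh (w j) := by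
  have hunits : ∀ r : ℝ, ∑ u : ℤˣ, Real.exp (r * ((u : ℤ) : ℝ)) = 2 * Real.cosh r := fun r ↦ by
    rw [show (univ : Finset ℤˣ) = {1, -1} from rfl, sum_pair (by decide), Real.cosh_eq]
    push_cast
    ring_nf
  have hprod : ∑ x : κ → ℤˣ, Real.exp (∑ j, w j * signVec x j)
      = ∏ j, ∑ u : ℤˣ, Real.exp (w j * ((u : ℤ) : ℝ)) := by
    rw [prod_univ_sum, Fintype.piFinset_univ]
    exact sum_congr rfl fun x _ ↦ Real.exp_sum _ _
  rw [Fintype.expect_eq_sum_div_card, hprod]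
  simp only [hunits, prod_mul_distrib]
  simp

lemma expect_exp_sum_mul_signVec_le (w : κ → ℝ) :
    𝔼 x : κ → ℤˣ, Real.exp (∑ j, w j * signVec x j) ≤ Real.exp ((∑ j, w j ^ 2) / 2) := by
  rw [expect_exp_sum_mul_signVec, sum_div, Real.exp_sum]
  exact prod_le_prod (fun j _ ↦ (Real.cosh_pos _).le) fun j _ ↦ Real.cosh_le_exp_half_sq _

lemma expect_exp_abs_sum_mul_signVec_le (w : κ → ℝ) :
    𝔼 x : κ → ℤˣ, Real.exp |∑ j, w j * signVec x j| ≤ 2 * Real.exp ((∑ j, w j ^ 2) / 2) :=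
  calc 𝔼 x : κ → ℤˣ, Real.exp |∑ j, w j * signVec x j|
      ≤ 𝔼 x : κ → ℤˣ, (Real.exp (∑ j, w j * signVec x j)
          + Real.exp (∑ j, -w j * signVec x j)) := by
        refine expect_le_expect fun x _ ↦ ?_
        simp only [neg_mul, sum_neg_distrib]
        exact Real.exp_abs_le _
    _ ≤ Real.exp ((∑ j, w j ^ 2) / 2) + Real.exp ((∑ j, (-w j) ^ 2) / 2) := by
        rw [expect_add_distrib]
        exact add_le_add (expect_exp_sum_mul_signVec_le _) (expect_exp_sum_mul_signVec_le _)
    _ = 2 * Real.exp ((∑ j, w j ^ 2) / 2) := by simp only [neg_sq, two_mul]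

/-- The signed sum of the set `S` of columns under the colouring `x`; its absolute value is the
discrepancy of `S`. -/
def signSum (S : Finset κ) (x : κ → ℤˣ) : ℝ := ∑ j ∈ S, signVec x j

lemma expect_exp_abs_signSum_sub_le (S T : Finset κ) (l : ℝ) :
    𝔼 x, Real.exp |l * (signSum S x - signSum T x)| ≤ 2 * Real.exp (l ^ 2 * #(S ∆ T) / 2) := by
  let w (j : κ) : ℝ := l * ((if j ∈ S then 1 else 0) - if j ∈ T then 1 else 0)
  have hsum : ∀ x, l * (signSum S x - signSum T x) = ∑ j, w j * signVec x j := fun x ↦ by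
    simp [w, signSum, mul_assoc, ← mul_sum, sub_mul, sum_sub_distrib]
  have hsq : ∑ j, w j ^ 2 = l ^ 2 * #(S ∆ T) := by
    have : ∀ j, w j ^ 2 = l ^ 2 * if j ∈ S ∆ T then 1 else 0 := fun j ↦ by
      by_cases hS : j ∈ S <;> by_cases hT : j ∈ T <;> simp [w, hS, hT, mem_symmDiff]
    simp [this, mul_comm]
  simpa only [hsum, hsq] using expect_exp_abs_sum_mul_signVec_le w

lemma expect_abs_signSum_sub_le {V : Finset (Finset κ × Finset κ)} {D : ℝ} (hD : 0 < D)
    (hV : ∀ q ∈ V, (#(q.1 ∆ q.2) : ℝ) ≤ D) {q : (κ → ℤˣ) → Finset κ × Finset κ}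
    (hq : ∀ x, q x ∈ V) :
    𝔼 x, |signSum (q x).1 x - signSum (q x).2 x| ≤ √(2 * D * Real.log (2 * #V)) := by
  have hcard : (1 : ℝ) ≤ #V := Nat.one_le_cast.2 (card_pos.2 ⟨_, hq 1⟩)
  set L := Real.log (2 * #V)
  have hL₀ : 0 < L := Real.log_pos (by linarith)
  -- This choice of `l` minimises the resulting bound `(L + l ^ 2 * D / 2) / l`.
  set l := √(2 * L / D) with hl
  have hl₀ : 0 < l := Real.sqrt_pos.2 (by positivity)
  have hlD : l ^ 2 * D = 2 * L := by
    rw [hl, Real.sq_sqrt (by positivity), div_mul_cancel₀ _ hD.ne']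
  have hmgf : ∀ q ∈ V, 𝔼 x, Real.exp (l * |signSum q.1 x - signSum q.2 x|)
      ≤ 2 * Real.exp (l ^ 2 * D / 2) := fun q hqV ↦ by
    have := hV q hqV
    calc 𝔼 x, Real.exp (l * |signSum q.1 x - signSum q.2 x|)
        = 𝔼 x, Real.exp |l * (signSum q.1 x - signSum q.2 x)| := by
          simp only [abs_mul, abs_of_pos hl₀]
      _ ≤ 2 * Real.exp (l ^ 2 * #(q.1 ∆ q.2) / 2) := expect_exp_abs_signSum_sub_le _ _ _
      _ ≤ 2 * Real.exp (l ^ 2 * D / 2) := by gcongr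
  calc 𝔼 x, |signSum (q x).1 x - signSum (q x).2 x|
      ≤ Real.log (#V * (2 * Real.exp (l ^ 2 * D / 2))) / l :=
        (expect_selection_le_log hl₀ hmgf hq :)
    _ = (L + l ^ 2 * D / 2) / l := by
        rw [← mul_assoc, mul_comm (#V : ℝ), Real.log_mul (by positivity) (by positivity),
          Real.log_exp]
    _ = l * D := by
        rw [div_eq_iff hl₀.ne']
        linear_combination -hlD / 2
    _ = √(2 * D * L) := by
        rw [eq_comm, Real.sqrt_eq_iff_mul_self_eq (by positivity) (by positivity)]
        linear_combination -D * hlD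

end Signs

section Chaining

variable {κ : Type*} [Fintype κ] [DecidableEq κ]

lemma sum_range_linear_div_two_pow_le (K : ℕ) :
    ∑ k ∈ range K, (2 * (k : ℝ) + 8) / 2 ^ k ≤ 20 := by
  have hclosed : ∑ k ∈ range K, (2 * (k : ℝ) + 8) / 2 ^ k = 20 - (4 * K + 20) / 2 ^ K := by
    induction K with
    | zero => norm_num
    | succ K ih =>
      rw [sum_range_succ, ih, pow_succ]
      push_cast
      field_simp
      ring
  rw [hclosed]
  exact sub_le_self _ (by positivity)

lemma IsChainingSeq.expect_abs_link_le [Nonempty κ] {𝓕 : Finset (Finset κ)} {d : ℕ}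
    {p : ℕ → Finset κ → Finset κ} (hp : IsChainingSeq 𝓕 d p) (hd : 1 ≤ d)
    {S : (κ → ℤˣ) → Finset κ} (hS : ∀ x, S x ∈ 𝓕) (k : ℕ) :
    𝔼 x, |signSum (p (k + 1) (S x)) x - signSum (p k (S x)) x|
      ≤ (2 * k + 8) / 2 ^ k * √(Fintype.card κ * d) := by
  let V := 𝓕.image fun T ↦ (p (k + 1) T, p k T)
  have hmem : ∀ x, (p (k + 1) (S x), p k (S x)) ∈ V := fun x ↦ mem_image_of_mem _ (hS x)
  have hV : ∀ q ∈ V, (#(q.1 ∆ q.2) : ℝ) ≤ 2 * Fintype.card κ / 4 ^ k :=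
    forall_mem_image.2 fun _ hT ↦ hp.card_symmDiff_succ_le k hT
  have hentropy : Real.log (2 * #V) ≤ d * (8 * k + 13) := by
    rw [Real.log_mul two_ne_zero (Nat.cast_ne_zero.2 (card_ne_zero_of_mem (hmem 1)))]
    have hd₁ : (1 : ℝ) ≤ d := Nat.one_le_cast.2 hd
    linarith [hp.log_card_image_pair_le k, Real.log_two_lt_d9]
  have hsq : (8 * k + 13 : ℝ) ≤ (k + 4) ^ 2 := by linarith [sq_nonneg (k : ℝ)]
  calc 𝔼 x, |signSum (p (k + 1) (S x)) x - signSum (p k (S x)) x|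
      ≤ √(2 * (2 * Fintype.card κ / 4 ^ k) * Real.log (2 * #V)) :=
        (expect_abs_signSum_sub_le (by positivity) hV hmem :)
    _ ≤ √(2 * (2 * Fintype.card κ / 4 ^ k) * (d * (k + 4) ^ 2)) := by
        gcongr
        exact hentropy.trans (by gcongr)
    _ = √(((2 * k + 8) / 2 ^ k) ^ 2 * (Fintype.card κ * d)) := by
        rw [div_pow, ← pow_mul, mul_comm k 2, pow_mul]
        norm_num
        ring_nf
    _ = (2 * k + 8) / 2 ^ k * √(Fintype.card κ * d) := by
        rw [Real.sqrt_mul (by positivity), Real.sqrt_sq (by positivity)]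

theorem expect_abs_signSum_le_of_vcDim_le [Nonempty κ] {𝓕 : Finset (Finset κ)} {d : ℕ} (hd : 1 ≤ d)
    (h𝓕 : 𝓕.vcDim ≤ d) {S : (κ → ℤˣ) → Finset κ} (hS : ∀ x, S x ∈ 𝓕) :
    𝔼 x, |signSum (S x) x| ≤ 20 * √(Fintype.card κ * d) := by
  obtain ⟨p, hp⟩ := exists_isChainingSeq hd h𝓕
  let link (k : ℕ) (x : κ → ℤˣ) : ℝ := signSum (p (k + 1) (S x)) x - signSum (p k (S x)) x
  have htelescope : ∀ x, signSum (S x) x = ∑ k ∈ range (Fintype.card κ), link k x := fun x ↦ by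
    rw [sum_range_sub (fun k ↦ signSum (p k (S x)) x), hp.apply_card_eq (hS x), hp.zero_eq_empty]
    simp [signSum]
  calc 𝔼 x, |signSum (S x) x|
      ≤ 𝔼 x, ∑ k ∈ range (Fintype.card κ), |link k x| := expect_le_expect fun x _ ↦ by
        rw [htelescope]
        exact abs_sum_le_sum_abs _ _
    _ = ∑ k ∈ range (Fintype.card κ), 𝔼 x, |link k x| := expect_sum_comm ..
    _ ≤ ∑ k ∈ range (Fintype.card κ), (2 * (k : ℝ) + 8) / 2 ^ k * √((Fintype.card κ : ℝ) * d) :=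
        sum_le_sum fun k _ ↦ hp.expect_abs_link_le hd hS k
    _ ≤ 20 * √(Fintype.card κ * d) := by
        rw [← sum_mul]
        gcongr
        exact sum_range_linear_div_two_pow_le _

end Chaining

section Matrices

variable {ι κ : Type*} [Fintype ι] [Fintype κ] [DecidableEq κ]

lemma one_le_vcDim {A : Matrix ι κ ℝ} (hA : ∀ i j, A i j = 0 ∨ A i j = 1)
    (hrows : ∃ i i', A i ≠ A i') : 1 ≤ vcDim A := by
  obtain ⟨i, i', hne⟩ := hrows
  refine one_le_vcDim_of_one_lt_card (one_lt_card.2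
    ⟨_, mem_image_of_mem _ (mem_univ i), _, mem_image_of_mem _ (mem_univ i'), fun h ↦ hne ?_⟩)
  funext j
  have hiff : A i j = 1 ↔ A i' j = 1 := by simpa using Finset.ext_iff.1 h j
  rcases hA i j with h₀ | h₁
  · exact h₀.trans ((hA i' j).resolve_right fun h₁ ↦ zero_ne_one (h₀.symm.trans (hiff.2 h₁))).symm
  · exact h₁.trans (hiff.1 h₁).symm

lemma vcDim_sub_le (A : Matrix ι κ ℝ) (I : Finset ι) (J : Finset κ) :
    vcDim (sub A I J) ≤ vcDim A := by
  have hsub : rowSets (sub A I J) ⊆ trace Subtype.val (rowSets A) := by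
    refine image_subset_iff.2 fun i _ ↦ mem_image.2 ⟨_, mem_image_of_mem _ (mem_univ i.1), ?_⟩
    ext j
    rw [mem_filter_univ, mem_filter_univ, mem_filter_univ]
    rfl
  exact (vcDim_mono hsub).trans (vcDim_trace_le _ _)

lemma exists_mem_rowSets_discColoring_eq [Nonempty ι] {A : Matrix ι κ ℝ}
    (hA : ∀ i j, A i j = 0 ∨ A i j = 1) (x : κ → ℤˣ) :
    ∃ S ∈ rowSets A, discColoring A x = |signSum S x| := by
  obtain ⟨i, hi : ‖A.mulVec (signVec x) i‖ = _⟩ := (IsGreatest.pi_norm (A.mulVec (signVec x))).1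
  refine ⟨_, mem_image_of_mem _ (mem_univ i), ?_⟩
  rw [discColoring, ← hi, Real.norm_eq_abs, signSum, sum_filter, Matrix.mulVec, dotProduct]
  congr 1
  refine sum_congr rfl fun j _ ↦ ?_
  rcases hA i j with h | h <;> simp [h]

theorem expect_discColoring_le {A : Matrix ι κ ℝ} (hA : ∀ i j, A i j = 0 ∨ A i j = 1) {d : ℕ}
    (hd : 1 ≤ d) (hAd : vcDim A ≤ d) :
    𝔼 x, discColoring A x ≤ 20 * √(Fintype.card κ * d) := by
  rcases isEmpty_or_nonempty ι with hι | hι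
  · have : ∀ x, discColoring A x = 0 := fun x ↦ by
      rw [discColoring, Subsingleton.elim (A.mulVec (signVec x)) 0, norm_zero]
    simp only [this, expect_const_zero]
    positivity
  rcases isEmpty_or_nonempty κ with hκ | hκ
  · have : ∀ x, discColoring A x = 0 := fun x ↦ by
      rw [discColoring, Subsingleton.elim (signVec x) 0, Matrix.mulVec_zero, norm_zero]
    simp only [this, expect_const_zero]
    positivity
  choose S hS hdisc using exists_mem_rowSets_discColoring_eq hA
  simpa only [hdisc] using expect_abs_signSum_le_of_vcDim_le hd hAd hS

lemma disc_le_expect_discColoring (A : Matrix ι κ ℝ) : disc A ≤ 𝔼 x, discColoring A x :=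
  le_expect univ_nonempty fun x _ ↦ ciInf_le (Set.finite_range _).bddBelow x

end Matrices

end HerDisc

open HerDisc in
theorem lemma11_general {ι κ : Type*} [Fintype ι] [Fintype κ] [DecidableEq κ] {A : Matrix ι κ ℝ}
    (hA : ∀ i j, A i j = 0 ∨ A i j = 1) (hrows : ∃ i i', A i ≠ A i') :
    herdisc A ≤ 20 * √(Fintype.card κ * vcDim A) ∧
      ∀ (I : Finset ι) (J : Finset κ),
        𝔼 x, discColoring (sub A I J) x ≤ 20 * √(Fintype.card κ * vcDim A) := by
  have hexpect (I : Finset ι) (J : Finset κ) :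
      𝔼 x, discColoring (sub A I J) x ≤ 20 * √(Fintype.card κ * vcDim A) := by
    refine (expect_discColoring_le (fun i j ↦ hA i.1 j.1) (one_le_vcDim hA hrows)
      (vcDim_sub_le A I J)).trans ?_
    gcongr
    simpa using card_le_univ J
  exact ⟨ciSup_le fun S ↦ (disc_le_expect_discColoring _).trans (hexpect S.1 S.2), hexpect⟩

theorem lemma11 :
    ∃ C : ℝ, 0 < C ∧
      ∀ (m n : ℕ) (A : Matrix (Fin m) (Fin n) ℝ),
        (∀ i j, A i j = 0 ∨ A i j = 1) →
        (∃ i i' : Fin m, A i ≠ A i') →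
          HerDisc.herdisc A ≤ C * Real.sqrt ((n : ℝ) * (HerDisc.vcDim A : ℝ)) ∧
          ∀ (I : Finset (Fin m)) (J : Finset (Fin n)),
            Finset.expect (Finset.univ : Finset (J → ℤˣ))
                (fun x => HerDisc.discColoring (HerDisc.sub A I J) x)
              ≤ C * Real.sqrt ((n : ℝ) * (HerDisc.vcDim A : ℝ)) := by
  exact ⟨20, by norm_num, fun m n A hA hrows ↦ by simpa using lemma11_general hA hrows⟩
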